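/- Let $\Bbbk$ be an algebraically closed field and let $A$ be a finite dimensional unital associative $\Bbbk$-algebra which is basic, i.e. all simple $A$-modules are one-dimensional over $\Bbbk$. Let $A\text{-}\mathrm{mod}$ be the category of finitely generated (equivalently, finite dimensional) left $A$-modules, and let $k>m\geq 1$ be integers. Let $\mathrm{F}$ be an additive $\Bbbk$-linear endofunctor of $A\text{-}\mathrm{mod}$ which is selfadjoint (i.e. adjoint to itself) and satisfies $\mathrm{F}^k\cong \mathrm{F}^m$, where $\mathrm{F}^n$ denotes the $n$-fold composition $\mathrm{F}\circ\cdots\circ\mathrm{F}$. (i) If $k-m$ is odd, then $\mathrm{F}^2\cong\mathrm{F}$. (Conversely, any endofunctor $\mathrm{G}$ of $A\text{-}\mathrm{mod}$ satisfying $\mathrm{G}^2\cong\mathrm{G}$ satisfies $\mathrm{G}^k\cong\mathrm{G}^m$.) (ii) If $k-m$ is even, then there are a decomposition $A\cong B\oplus C$ into a direct sum of $\Bbbk$-algebras (each unital or zero) and a $\Bbbk$-algebra automorphism $\varphi:B\to B$ such that $\varphi^2$ is inner (i.e. of the form $b\mapsto sbs^{-1}$ for some invertible $s\in B$) and $\mathrm{F}\cong\mathrm{F}_\varphi\boxplus\mathbf{0}$.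 Here $\mathrm{F}_\varphi={}_\varphi B\otimes_B{}_-:B\text{-}\mathrm{mod}\to B\text{-}\mathrm{mod}$, where ${}_\varphi B$ is the bimodule $B$ with actions $a\cdot x\cdot b=\varphi(a)xb$; $\mathbf{0}$ is the zero endofunctor of $C\text{-}\mathrm{mod}$; and $\mathrm{F}_\varphi\boxplus\mathbf{0}$ is the endofunctor of $A\text{-}\mathrm{mod}\simeq B\text{-}\mathrm{mod}\oplus C\text{-}\mathrm{mod}$ acting componentwise by $\mathrm{F}_\varphi$ and $\mathbf{0}$. -/

import Mathlib

universe v u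

open CategoryTheory
open scoped TensorProduct

noncomputable section

namespace SelfadjointFunctors

/-- A finite dimensional algebra over `k` (algebraically closed in the application) is basic if all
its simple left modules are one-dimensional over `k`. -/
def IsBasicAlgebra (k : Type v) (A : Type u) [Field k] [Ring A] [Algebra k A] : Prop :=
  ∀ (L : Type u) [AddCommGroup L] [Module k L] [Module A L] [IsScalarTower k A L],
    IsSimpleModule A L → Module.finrank k L = 1

/-- The composition power `F^n = F ∘ F ∘ ⋯ ∘ F` of an endofunctor. -/
def functorPow {C : Type*} [Category C] (F : C ⥤ C) : ℕ → (C ⥤ C)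
  | 0 => 𝟭 C
  | n + 1 => functorPow F n ⋙ F

/-- `F` is selfadjoint: it is left (equivalently right) adjoint to itself. -/
def IsSelfadjointFunctor {C : Type*} [Category C] (F : C ⥤ C) : Prop :=
  Nonempty (F ⊣ F)

/-! ### Tensor product of a bimodule with a left module over a noncommutative ring -/

section Tensor

variable (R S : Type*) [Ring R] [Ring S]
variable (X : Type*) [AddCommGroup X] [Module S X] [Module Rᵐᵒᵖ X]
variable (M : Type*) [AddCommGroup M] [Module R M]

/-- The relations `(x r) ⊗ m - x ⊗ (r m)`. (When the left `S`- and the right `R`-action on `X`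
commute, the set of these elements is stable under `S`, so that its `S`-span is its additive
span.) -/
def balancedRelations : Submodule S (X ⊗[ℤ] M) :=
  Submodule.span S {t | ∃ (x : X) (r : R) (m : M),
    t = (MulOpposite.op r • x) ⊗ₜ[ℤ] m - x ⊗ₜ[ℤ] (r • m)}

/-- The left `S`-module `X ⊗_R M`, for an `S`-`R`-bimodule `X` and a left `R`-module `M`. -/
abbrev BalancedTensor [SMulCommClass S Rᵐᵒᵖ X] : Type _ :=
  (X ⊗[ℤ] M) ⧸ balancedRelations R S X M

variable {M} {N : Type*} [AddCommGroup N] [Module R N]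

/-- The map `X ⊗ M → X ⊗ N` over `ℤ` induced by `f : M → N`, as an `S`-linear map. -/
def preTensorMap (f : M →ₗ[R] N) : X ⊗[ℤ] M →ₗ[S] X ⊗[ℤ] N :=
  TensorProduct.AlgebraTensorModule.map (LinearMap.id : X →ₗ[S] X) (f.restrictScalars ℤ)

theorem preTensorMap_tmul (f : M →ₗ[R] N) (x : X) (m : M) :
    preTensorMap R S X f (x ⊗ₜ[ℤ] m) = x ⊗ₜ[ℤ] f m := rfl

theorem balancedRelations_le_comap (f : M →ₗ[R] N) :
    balancedRelations R S X M ≤ (balancedRelations R S X N).comap (preTensorMap R S X f) := by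
  refine Submodule.span_le.2 ?_
  rintro _ ⟨x, r, m, rfl⟩
  refine Submodule.subset_span ⟨x, r, f m, ?_⟩
  rw [map_sub, preTensorMap_tmul, preTensorMap_tmul, map_smul]

/-- The map `X ⊗_R f : X ⊗_R M → X ⊗_R N`. -/
def balancedTensorMap [SMulCommClass S Rᵐᵒᵖ X] (f : M →ₗ[R] N) :
    BalancedTensor R S X M →ₗ[S] BalancedTensor R S X N :=
  Submodule.mapQ _ _ (preTensorMap R S X f) (balancedRelations_le_comap R S X f)

end Tensor

/-! ### The functor `F_φ` -/

section Twist

variable {k : Type v} [Field k] {B : Type u} [Ring B] [Algebra k B]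

/-- The bimodule `B` with left action twisted by `φ`, i.e. `a · x · b = φ(a) x b`. -/
def TwistedBimodule (_φ : B ≃ₐ[k] B) : Type u := B

variable (φ : B ≃ₐ[k] B)

instance : AddCommGroup (TwistedBimodule φ) := inferInstanceAs (AddCommGroup B)

instance : Module Bᵐᵒᵖ (TwistedBimodule φ) := inferInstanceAs (Module Bᵐᵒᵖ B)

instance : Module B (TwistedBimodule φ) := Module.compHom B (φ : B →+* B)

theorem TwistedBimodule.smul_def (a x : B) :
    (a • (show TwistedBimodule φ from x) : TwistedBimodule φ) = (φ a * x : B) := rfl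

theorem TwistedBimodule.op_smul_def (b x : B) :
    (MulOpposite.op b • (show TwistedBimodule φ from x) : TwistedBimodule φ) = (x * b : B) := rfl

instance : SMulCommClass B Bᵐᵒᵖ (TwistedBimodule φ) where
  smul_comm a b x := (mul_assoc (φ a) (show B from x) b.unop).symm

/-- If `M` is finitely generated, then so is the twisted bimodule tensored with `M`. -/
instance (M : Type u) [AddCommGroup M] [Module B M] [Module.Finite B M] :
    Module.Finite B (BalancedTensor B B (TwistedBimodule φ) M) := by
  let one : TwistedBimodule φ := (1 : B)
  let q := (balancedRelations B B (TwistedBimodule φ) M).mkQ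
  have key : ∀ (x : TwistedBimodule φ) (m : M),
      q (x ⊗ₜ[ℤ] m) = q (one ⊗ₜ[ℤ] ((show B from x) • m)) := by
    intro x m
    rw [← sub_eq_zero, ← map_sub]
    refine (Submodule.Quotient.mk_eq_zero _).2 (Submodule.subset_span ⟨one, x, m, ?_⟩)
    have h : MulOpposite.op (show B from x) • one = x := one_mul (show B from x)
    rw [h]
  obtain ⟨s, hs⟩ := (Module.Finite.fg_top : (⊤ : Submodule B M).FG)
  classical
  refine ⟨⟨s.image fun m => q (one ⊗ₜ[ℤ] m), ?_⟩⟩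
  have h1 : ∀ m : M, q (one ⊗ₜ[ℤ] m) ∈
      Submodule.span B (↑(s.image fun m => q (one ⊗ₜ[ℤ] m)) :
        Set (BalancedTensor B B (TwistedBimodule φ) M)) := by
    intro m
    have hm : m ∈ Submodule.span B (s : Set M) := by rw [hs]; trivial
    induction hm using Submodule.span_induction with
    | mem x hx => exact Submodule.subset_span (by
        rw [Finset.coe_image]; exact ⟨x, hx, rfl⟩)
    | zero => rw [TensorProduct.tmul_zero, map_zero]; exact Submodule.zero_mem _
    | add x y _ _ hx hy => rw [TensorProduct.tmul_add, map_add]; exact Submodule.add_mem _ hx hy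
    | smul b x _ hx =>
      have h2 : (φ.symm b • one : TwistedBimodule φ) = b := by
        change φ (φ.symm b) * 1 = b
        rw [mul_one, AlgEquiv.apply_symm_apply]
      have h3 : q (one ⊗ₜ[ℤ] (b • x)) = φ.symm b • q (one ⊗ₜ[ℤ] x) := by
        rw [← map_smul, TensorProduct.smul_tmul', h2]
        exact (key b x).symm
      rw [h3]
      exact Submodule.smul_mem _ _ hx
  rw [eq_top_iff]
  rintro y -
  obtain ⟨t, rfl⟩ := (balancedRelations B B (TwistedBimodule φ) M).mkQ_surjective y
  induction t using TensorProduct.induction_on with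
  | zero => rw [map_zero]; exact Submodule.zero_mem _
  | tmul x m => rw [show _ = _ from key x m]; exact h1 _
  | add x y hx hy => rw [map_add]; exact Submodule.add_mem _ hx hy

/-- The endofunctor `F_φ`, tensoring over `B` with the bimodule `B` twisted by `φ` on the left,
of the category of finitely generated `B`-modules. -/
def twistFunctor : FGModuleCat.{u} B ⥤ FGModuleCat.{u} B where
  obj M := FGModuleCat.of B (BalancedTensor B B (TwistedBimodule φ) M)
  map f := FGModuleCat.ofHom (balancedTensorMap B B (TwistedBimodule φ) f.hom.hom)
  map_id M := by
    ext : 1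
    refine Submodule.linearMap_qext _ (TensorProduct.AlgebraTensorModule.ext fun x m => rfl)
  map_comp f g := by
    ext : 1
    refine Submodule.linearMap_qext _ (TensorProduct.AlgebraTensorModule.ext fun x m => rfl)

end Twist

/-- An automorphism of the form `b ↦ s b s⁻¹` for an invertible `s`. -/
def IsInnerAut {k : Type v} [Field k] {B : Type u} [Ring B] [Algebra k B]
    (φ : B ≃ₐ[k] B) : Prop :=
  ∃ s : Bˣ, ∀ b : B, φ b = s * b * (s⁻¹ : Bˣ)

/-! ### External direct sums -/

/-- Restriction of scalars along a surjective ring homomorphism, on finitely generated modules. -/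
def restrictFG {R S : Type u} [Ring R] [Ring S] (f : R →+* S) (hf : Function.Surjective f) :
    FGModuleCat.{u} S ⥤ FGModuleCat.{u} R where
  obj M := ⟨(ModuleCat.restrictScalars.{u} f).obj M.obj, by
    let _ : Module R M := Module.compHom M f
    obtain ⟨s, hs⟩ := (Module.Finite.fg_top : (⊤ : Submodule S M).FG)
    refine ⟨⟨s, ?_⟩⟩
    rw [eq_top_iff]
    rintro (m : M) -
    have hm : m ∈ Submodule.span S (s : Set M) := by rw [hs]; trivial
    induction hm using Submodule.span_induction with
    | mem x hx => exact Submodule.subset_span hx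
    | zero => exact Submodule.zero_mem _
    | add x y _ _ hx hy => exact Submodule.add_mem _ hx hy
    | smul b x _ hx =>
      obtain ⟨r, rfl⟩ := hf b
      exact Submodule.smul_mem _ r hx⟩
  map g := ObjectProperty.homMk ((ModuleCat.restrictScalars.{u} f).map g.hom)

section ExternalSum

variable {B C : Type u} [Ring B] [Ring C]

/-- The `B`-component `(1, 0) M` of a module `M` over `B × C`. -/
def FstPart (M : Type u) [AddCommGroup M] [Module (B × C) M] : AddSubgroup M where
  carrier := {m | ((1, 0) : B × C) • m = m}
  zero_mem' := smul_zero _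
  add_mem' {x y} (hx : _ = _) (hy : _ = _) := by
    change _ • (x + y) = x + y
    rw [smul_add, hx, hy]
  neg_mem' {x} (hx : _ = _) := by
    change _ • (-x) = -x
    rw [smul_neg, hx]

/-- The `C`-component `(0, 1) M` of a module `M` over `B × C`. -/
def SndPart (M : Type u) [AddCommGroup M] [Module (B × C) M] : AddSubgroup M where
  carrier := {m | ((0, 1) : B × C) • m = m}
  zero_mem' := smul_zero _
  add_mem' {x y} (hx : _ = _) (hy : _ = _) := by
    change _ • (x + y) = x + y
    rw [smul_add, hx, hy]
  neg_mem' {x} (hx : _ = _) := by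
    change _ • (-x) = -x
    rw [smul_neg, hx]

section Parts

variable (M : Type u) [AddCommGroup M] [Module (B × C) M]

/-- `b ∈ B` acts on the `B`-component as `(b, 0)`. -/
instance : Module B (FstPart (B := B) (C := C) M) where
  smul b m := ⟨((b, 0) : B × C) • (m : M), by
    change ((1, 0) : B × C) • ((b, 0) : B × C) • (m : M) = ((b, 0) : B × C) • (m : M)
    rw [smul_smul]; simp⟩
  one_smul m := Subtype.ext m.2
  mul_smul a b m := Subtype.ext (by
    change ((a * b, 0) : B × C) • (m : M) = ((a, 0) : B × C) • ((b, 0) : B × C) • (m : M)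
    rw [smul_smul]; simp)
  smul_zero b := Subtype.ext (smul_zero _)
  smul_add b x y := Subtype.ext (smul_add _ _ _)
  add_smul a b m := Subtype.ext (by
    change ((a + b, 0) : B × C) • (m : M) = ((a, 0) : B × C) • (m : M) + ((b, 0) : B × C) • (m : M)
    rw [← add_smul]; simp)
  zero_smul m := Subtype.ext (zero_smul (B × C) (m : M))

/-- `c ∈ C` acts on the `C`-component as `(0, c)`. -/
instance : Module C (SndPart (B := B) (C := C) M) where
  smul b m := ⟨((0, b) : B × C) • (m : M), by
    change ((0, 1) : B × C) • ((0, b) : B × C) • (m : M) = ((0, b) : B × C) • (m : M)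
    rw [smul_smul]; simp⟩
  one_smul m := Subtype.ext m.2
  mul_smul a b m := Subtype.ext (by
    change ((0, a * b) : B × C) • (m : M) = ((0, a) : B × C) • ((0, b) : B × C) • (m : M)
    rw [smul_smul]; simp)
  smul_zero b := Subtype.ext (smul_zero _)
  smul_add b x y := Subtype.ext (smul_add _ _ _)
  add_smul a b m := Subtype.ext (by
    change ((0, a + b) : B × C) • (m : M) = ((0, a) : B × C) • (m : M) + ((0, b) : B × C) • (m : M)
    rw [← add_smul]; simp)
  zero_smul m := Subtype.ext (zero_smul (B × C) (m : M))

/-- Multiplication by `(1, 0)` as a map onto the `B`-component. -/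
def toFstPart : M →ₛₗ[RingHom.fst B C] FstPart (B := B) (C := C) M where
  toFun m := ⟨((1, 0) : B × C) • m, by
    change ((1, 0) : B × C) • ((1, 0) : B × C) • m = ((1, 0) : B × C) • m
    rw [smul_smul]; simp⟩
  map_add' x y := Subtype.ext (smul_add _ _ _)
  map_smul' r m := Subtype.ext (by
    change ((1, 0) : B × C) • r • m = ((r.1, 0) : B × C) • ((1, 0) : B × C) • m
    rw [smul_smul, smul_smul]; congr 1; ext <;> simp)

/-- Multiplication by `(0, 1)` as a map onto the `C`-component. -/
def toSndPart : M →ₛₗ[RingHom.snd B C] SndPart (B := B) (C := C) M where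
  toFun m := ⟨((0, 1) : B × C) • m, by
    change ((0, 1) : B × C) • ((0, 1) : B × C) • m = ((0, 1) : B × C) • m
    rw [smul_smul]; simp⟩
  map_add' x y := Subtype.ext (smul_add _ _ _)
  map_smul' r m := Subtype.ext (by
    change ((0, 1) : B × C) • r • m = ((0, r.2) : B × C) • ((0, 1) : B × C) • m
    rw [smul_smul, smul_smul]; congr 1; ext <;> simp)

instance [Module.Finite (B × C) M] : Module.Finite B (FstPart (B := B) (C := C) M) :=
  haveI : RingHomSurjective (RingHom.fst B C) := ⟨Prod.fst_surjective⟩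
  Module.Finite.of_surjective (toFstPart M) fun m => ⟨m, Subtype.ext m.2⟩

instance [Module.Finite (B × C) M] : Module.Finite C (SndPart (B := B) (C := C) M) :=
  haveI : RingHomSurjective (RingHom.snd B C) := ⟨Prod.snd_surjective⟩
  Module.Finite.of_surjective (toSndPart M) fun m => ⟨m, Subtype.ext m.2⟩

variable {M} {N : Type u} [AddCommGroup N] [Module (B × C) N]

/-- The restriction of a homomorphism to the `B`-components. -/
def fstPartMap (f : M →ₗ[B × C] N) :
    FstPart (B := B) (C := C) M →ₗ[B] FstPart (B := B) (C := C) N where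
  toFun m := ⟨f m, by
    change ((1, 0) : B × C) • f m = f m
    rw [← map_smul]; exact congrArg f m.2⟩
  map_add' x y := Subtype.ext (map_add f _ _)
  map_smul' b x := Subtype.ext (map_smul f _ _)

/-- The restriction of a homomorphism to the `C`-components. -/
def sndPartMap (f : M →ₗ[B × C] N) :
    SndPart (B := B) (C := C) M →ₗ[C] SndPart (B := B) (C := C) N where
  toFun m := ⟨f m, by
    change ((0, 1) : B × C) • f m = f m
    rw [← map_smul]; exact congrArg f m.2⟩
  map_add' x y := Subtype.ext (map_add f _ _)
  map_smul' b x := Subtype.ext (map_smul f _ _)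

end Parts

variable (B C) in
/-- The functor `M ↦ (1, 0) M` from `B × C`-modules to `B`-modules. -/
def fstFunctor : FGModuleCat.{u} (B × C) ⥤ FGModuleCat.{u} B where
  obj M := FGModuleCat.of B (FstPart (B := B) (C := C) M)
  map f := FGModuleCat.ofHom (fstPartMap f.hom.hom)

variable (B C) in
/-- The functor `M ↦ (0, 1) M` from `B × C`-modules to `C`-modules. -/
def sndFunctor : FGModuleCat.{u} (B × C) ⥤ FGModuleCat.{u} C where
  obj M := FGModuleCat.of C (SndPart (B := B) (C := C) M)
  map f := FGModuleCat.ofHom (sndPartMap f.hom.hom)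

/-- The external direct sum `F₁ ⊞ F₂`, acting componentwise on modules over `B × C`: it sends `M`,
with components `M₁` and `M₂`, to `F₁ M₁ × F₂ M₂`, on which `B × C` acts componentwise. -/
def externalSum (F₁ : FGModuleCat.{u} B ⥤ FGModuleCat.{u} B)
    (F₂ : FGModuleCat.{u} C ⥤ FGModuleCat.{u} C) :
    FGModuleCat.{u} (B × C) ⥤ FGModuleCat.{u} (B × C) :=
  let G₁ := fstFunctor B C ⋙ F₁ ⋙ restrictFG (RingHom.fst B C) Prod.fst_surjective
  let G₂ := sndFunctor B C ⋙ F₂ ⋙ restrictFG (RingHom.snd B C) Prod.snd_surjective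
  { obj := fun M => FGModuleCat.of (B × C) (G₁.obj M × G₂.obj M)
    map := fun f => FGModuleCat.ofHom (LinearMap.prodMap (G₁.map f).hom.hom (G₂.map f).hom.hom)
    map_id := fun M => by
      rw [G₁.map_id, G₂.map_id]; rfl
    map_comp := fun f g => by
      rw [G₁.map_comp, G₂.map_comp]; rfl }

end ExternalSum

/-- The zero endofunctor: every module is sent to the zero module. -/
def zeroFunctor (C : Type u) [Ring C] : FGModuleCat.{u} C ⥤ FGModuleCat.{u} C :=
  (Functor.const _).obj (FGModuleCat.of C PUnit.{u + 1})

/-- Transport of an endofunctor of `S`-modules to `R`-modules along a ring isomorphism `R ≃ S`. -/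
def transportFunctor {R S : Type u} [Ring R] [Ring S] (e : R ≃+* S)
    (F : FGModuleCat.{u} S ⥤ FGModuleCat.{u} S) : FGModuleCat.{u} R ⥤ FGModuleCat.{u} R :=
  restrictFG (e.symm : S →+* R) e.symm.surjective ⋙ F ⋙ restrictFG (e : R →+* S) e.surjective

end SelfadjointFunctors

end

noncomputable section

/-! Let η and ε be the unit and counit of `F ⊣ F`. By the triangle identities F(η) is a split mono
and F(ε) a split epi, so dim FⁿX ≤ dim Fⁿ⁺²X for n ≥ 1. The isomorphism F^k ≅ F^m makes these
dimensions periodic, so the growth stops: F^m(η) and F^m(ε) are bijective. A map out of, or into, a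
module FY vanishes as soon as F kills it; hence every η_X is epi and every ε_X is mono
(`epi_unit_app`, `mono_counit_app`).

Since the left adjoint F preserves epis, F(η) is an isomorphism F ≅ F³. Positive powers of F then
depend only on the parity of the exponent, which settles the odd case.

For the decomposition, ε mono makes F² a natural direct summand of the identity functor, so F²X ≅ eX
for a central idempotent e (`exists_central_idempotent`). Basicness enters through simple modules L:
FL is zero or simple, so dim FL ≤ 1. As Hom(FA, L) ≅ FL, each character of A belongs to at most one
maximal submodule of FA. There are thus finitely many of these, and over an infinite field some
vector t avoids them all and generates FA. A dimension count shows that t and e have the same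
annihilator, so FA ≅ Ae and FM ≅ Hom(A, FM) ≅ Hom(FA, M) ≅ eM, with a twisted action of A
(`exists_twistData`). The twist descends to an automorphism φ of B = A/ann(e), and comparing F² with
multiplication by e shows that φ² is inner (`TwistData.exists_inner`). -/

namespace SelfadjointFunctors

/-! ### Powers of an endofunctor -/

section Powers

variable {C : Type*} [Category C]

/-- Isomorphic endofunctors stay isomorphic after composition with `F`. -/
theorem functorPow_add_iso (F : C ⥤ C) {a b : ℕ}
    (h : Nonempty (functorPow F a ≅ functorPow F b)) (n : ℕ) :
    Nonempty (functorPow F (a + n) ≅ functorPow F (b + n)) := by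
  induction n with
  | zero => exact h
  | succ n ih => exact ⟨Functor.isoWhiskerRight ih.some F⟩

theorem functorPow_one_iso (F : C ⥤ C) : Nonempty (functorPow F 1 ≅ F) :=
  ⟨F.leftUnitor⟩

theorem functorPow_iso_of_idempotent (F : C ⥤ C) (h : Nonempty (functorPow F 2 ≅ F))
    {n : ℕ} (hn : 1 ≤ n) : Nonempty (functorPow F n ≅ F) := by
  induction n, hn using Nat.le_induction with
  | base => exact functorPow_one_iso F
  | succ n _ ih =>
    exact ⟨Functor.isoWhiskerRight (ih.some ≪≫ (functorPow_one_iso F).some.symm) F ≪≫ h.some⟩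

/-- Given F³ ≅ F, positive exponents matter only modulo 2, and `k`, `m` have opposite parities. -/
theorem functorPow_iso_of_odd_sub (F : C ⥤ C)
    (h3 : Nonempty (functorPow F 3 ≅ functorPow F 1)) {k m : ℕ} (hm : 1 ≤ m)
    (hkm : Nonempty (functorPow F k ≅ functorPow F m)) (hodd : Odd (k - m)) :
    Nonempty (functorPow F 2 ≅ F) := by
  have key : ∀ n j : ℕ, Nonempty (functorPow F (1 + n + 2 * j) ≅ functorPow F (1 + n)) := by
    intro n j
    induction j with
    | zero => exact ⟨Iso.refl _⟩
    | succ j ih =>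
      have h := functorPow_add_iso F h3 (n + 2 * j)
      rw [show 3 + (n + 2 * j) = 1 + n + 2 * (j + 1) by ring,
        show 1 + (n + 2 * j) = 1 + n + 2 * j by ring] at h
      exact ⟨h.some ≪≫ ih.some⟩
  obtain ⟨d, hd⟩ := hodd
  have h2 : Nonempty (functorPow F 2 ≅ functorPow F 1) := by
    rcases Nat.even_or_odd' m with ⟨q, hq | hq⟩
    -- Here m = 2q with q ≥ 1, so the truncated `q - 1` is a genuine difference.
    · have h1 := key 0 (q + d)
      have h2 := key 1 (q - 1)
      rw [show 1 + 0 + 2 * (q + d) = k by lia] at h1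
      rw [show 1 + 1 + 2 * (q - 1) = m by lia] at h2
      exact ⟨h2.some.symm ≪≫ hkm.some.symm ≪≫ h1.some⟩
    · have h1 := key 0 q
      have h2 := key 1 (q + d)
      rw [show 1 + 0 + 2 * q = m by lia] at h1
      rw [show 1 + 1 + 2 * (q + d) = k by lia] at h2
      exact ⟨h2.some.symm ≪≫ hkm.some ≪≫ h1.some⟩
  exact ⟨h2.some ≪≫ (functorPow_one_iso F).some⟩

/-- `F ∘ F^n ≅ F^n ∘ F`, naturally. -/
theorem functorPow_succ_iso (F : C ⥤ C) (n : ℕ) :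
    Nonempty (functorPow F (n + 1) ≅ F ⋙ functorPow F n) := by
  induction n with
  | zero => exact ⟨Iso.refl _⟩
  | succ n ih => exact ⟨Functor.isoWhiskerRight ih.some F⟩

theorem functorPow_succ_map {F : C ⥤ C} {n : ℕ}
    (α : functorPow F (n + 1) ≅ F ⋙ functorPow F n) {X Y : C} (f : X ⟶ Y) :
    (functorPow F (n + 1)).map f =
      α.hom.app X ≫ (functorPow F n).map (F.map f) ≫ α.inv.app Y := by
  have := α.hom.naturality f
  change _ = _ ≫ (functorPow F n).map (F.map _) at this
  rw [← reassoc_of% this, Iso.hom_inv_id_app, Category.comp_id]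

end Powers

/-! ### Units and counits of a selfadjunction -/

section Adjunction

variable {C : Type*} [Category C] [Preadditive C] {F : C ⥤ C} [F.Additive] (adj : F ⊣ F)

include adj

/-- The adjoint transpose of `g` is η followed by F(g), and transposition is injective. -/
theorem eq_zero_of_map_eq_zero {Y K : C} (g : F.obj Y ⟶ K) (h : F.map g = 0) : g = 0 := by
  apply (adj.homEquiv Y K).injective
  rw [adj.homEquiv_unit, adj.homEquiv_unit, h, F.map_zero]

theorem eq_zero_of_map_eq_zero' {Y K : C} (g : K ⟶ F.obj Y) (h : F.map g = 0) : g = 0 := by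
  apply (adj.homEquiv K Y).symm.injective
  rw [adj.homEquiv_counit, adj.homEquiv_counit, h, F.map_zero]

theorem map_functorPow_eq_zero {Y K : C} (g : F.obj Y ⟶ K) (n : ℕ)
    (h : (functorPow F n).map g = 0) : g = 0 := by
  induction n generalizing Y K with
  | zero => exact h
  | succ n ih =>
    apply eq_zero_of_map_eq_zero adj
    apply ih
    let α := (functorPow_succ_iso F n).some
    have := α.hom.naturality g
    rw [h, Limits.zero_comp] at this
    rw [← cancel_epi (α.hom.app _)]
    exact this.symm.trans Limits.comp_zero.symm

theorem map_functorPow_eq_zero' {Y K : C} (g : K ⟶ F.obj Y) (n : ℕ)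
    (h : (functorPow F n).map g = 0) : g = 0 := by
  induction n generalizing Y K with
  | zero => exact h
  | succ n ih =>
    apply eq_zero_of_map_eq_zero' adj
    apply ih
    let α := (functorPow_succ_iso F n).some
    have := α.hom.naturality g
    rw [h, Limits.zero_comp] at this
    rw [← cancel_epi (α.hom.app _)]
    exact this.symm.trans Limits.comp_zero.symm

instance functorPow_additive (n : ℕ) : (functorPow F n).Additive := by
  induction n with
  | zero => exact inferInstanceAs (𝟭 C).Additive
  | succ n ih => exact inferInstanceAs (functorPow F n ⋙ F).Additive

theorem epi_unit_of_epi_map (n : ℕ) (X : C) (h : Epi ((functorPow F n).map (adj.unit.app X))) :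
    Epi (adj.unit.app X) := by
  refine Preadditive.epi_of_cancel_zero _ fun {K} q hq => ?_
  refine map_functorPow_eq_zero adj (Y := F.obj X) q n ?_
  rw [← cancel_epi ((functorPow F n).map (adj.unit.app X)), Limits.comp_zero]
  have := congrArg (functorPow F n).map hq
  rwa [Functor.map_comp, Functor.map_zero] at this

theorem mono_counit_of_mono_map (n : ℕ) (X : C)
    (h : Mono ((functorPow F n).map (adj.counit.app X))) :
    Mono (adj.counit.app X) := by
  refine Preadditive.mono_of_cancel_zero _ fun {K} q hq => ?_
  refine map_functorPow_eq_zero' adj (Y := F.obj X) q n ?_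
  rw [← cancel_mono ((functorPow F n).map (adj.counit.app X)), Limits.zero_comp]
  have := congrArg (functorPow F n).map hq
  rwa [Functor.map_comp, Functor.map_zero] at this

omit [Preadditive C] [F.Additive]

theorem isSplitMono_functorPow_map_unit (n : ℕ) (X : C) :
    IsSplitMono ((functorPow F (n + 1)).map (adj.unit.app X)) := by
  let α := (functorPow_succ_iso F n).some
  have h : IsSplitMono (F.map (adj.unit.app X)) :=
    ⟨⟨adj.counit.app (F.obj X), adj.left_triangle_components X⟩⟩
  have h2 : IsSplitMono ((functorPow F n).map (F.map (adj.unit.app X))) := inferInstance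
  have h3 : IsSplitMono (α.hom.app _ ≫ (functorPow F n).map (F.map (adj.unit.app X)) ≫ α.inv.app _) :=
    inferInstance
  rwa [← functorPow_succ_map α] at h3

theorem isSplitEpi_functorPow_map_counit (n : ℕ) (X : C) :
    IsSplitEpi ((functorPow F (n + 1)).map (adj.counit.app X)) := by
  let α := (functorPow_succ_iso F n).some
  have h : IsSplitEpi (F.map (adj.counit.app X)) :=
    ⟨⟨adj.unit.app (F.obj X), adj.right_triangle_components X⟩⟩
  have h2 : IsSplitEpi ((functorPow F n).map (F.map (adj.counit.app X))) := inferInstance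
  have h3 : IsSplitEpi (α.hom.app _ ≫ (functorPow F n).map (F.map (adj.counit.app X)) ≫ α.inv.app _) :=
    inferInstance
  rwa [← functorPow_succ_map α] at h3

theorem isIso_map_unit (h : ∀ X, Epi (adj.unit.app X)) (X : C) :
    IsIso (F.map (adj.unit.app X)) := by
  have := h X
  have : IsSplitMono (F.map (adj.unit.app X)) :=
    ⟨⟨adj.counit.app (F.obj X), adj.left_triangle_components X⟩⟩
  have := adj.isLeftAdjoint
  exact isIso_of_epi_of_isSplitMono _

theorem isIso_map_counit (h : ∀ X, Mono (adj.counit.app X)) (X : C) :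
    IsIso (F.map (adj.counit.app X)) := by
  have := h X
  have : IsSplitEpi (F.map (adj.counit.app X)) :=
    ⟨⟨adj.unit.app (F.obj X), adj.right_triangle_components X⟩⟩
  have := adj.isRightAdjoint
  exact isIso_of_mono_of_isSplitEpi _

/-- The triangle identity exhibits this unit as a right inverse of the isomorphism F(ε). -/
theorem isIso_unit_obj (h : ∀ X, Mono (adj.counit.app X)) (X : C) :
    IsIso (adj.unit.app (F.obj X)) := by
  have := isIso_map_counit adj h X
  have h2 := adj.right_triangle_components X
  exact @IsIso.of_isIso_fac_right _ _ _ _ _ _ _ _ this (IsIso.id _) h2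

/-- Naturality of η at ε_X rewrites the composite as a unit at F²X followed by F²(ε_X), both
invertible. This makes ε_X a split mono, naturally in X. -/
theorem isIso_counit_comp_unit (hε : ∀ X, Mono (adj.counit.app X)) (X : C) :
    IsIso (adj.counit.app X ≫ adj.unit.app X) := by
  have h := adj.unit.naturality (adj.counit.app X)
  have h1 := isIso_map_counit adj hε X
  have h2 : IsIso (adj.unit.app (F.obj (F.obj X))) := isIso_unit_obj adj hε (F.obj X)
  change adj.counit.app X ≫ adj.unit.app X =
    adj.unit.app (F.obj (F.obj X)) ≫ F.map (F.map (adj.counit.app X)) at h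
  rw [h]
  infer_instance

theorem functorPow_three_iso (hη : ∀ X, Epi (adj.unit.app X)) :
    Nonempty (functorPow F 3 ≅ functorPow F 1) := by
  exact ⟨(NatIso.ofComponents (fun X => @asIso _ _ _ _ _ (isIso_map_unit adj hη X)) (fun {X Y} f => by
    have h := adj.unit.naturality f
    have h2 := congrArg F.map h
    rw [F.map_comp, F.map_comp] at h2
    exact h2) : functorPow F 1 ≅ functorPow F 3).symm⟩

end Adjunction

/-! ### Morphisms of finitely generated modules -/

section Modules

variable {A : Type u} [Ring A] {X Y Z : FGModuleCat.{u} A}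

theorem hom_comp_apply (f : X ⟶ Y) (g : Y ⟶ Z) (x : X) :
    (f ≫ g).hom.hom x = g.hom.hom (f.hom.hom x) := rfl

theorem injective_of_isSplitMono (f : X ⟶ Y) [IsSplitMono f] :
    Function.Injective f.hom.hom := fun x y h => by
  have h1 : ∀ z, (retraction f).hom.hom (f.hom.hom z) = z := fun z => by
    rw [← hom_comp_apply, IsSplitMono.id]; rfl
  rw [← h1 x, h, h1]

theorem surjective_of_isSplitEpi (f : X ⟶ Y) [IsSplitEpi f] :
    Function.Surjective f.hom.hom := fun y =>
  ⟨(section_ f).hom.hom y, by rw [← hom_comp_apply, IsSplitEpi.id]; rfl⟩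

theorem bijective_of_isIso (f : X ⟶ Y) [IsIso f] : Function.Bijective f.hom.hom :=
  ⟨injective_of_isSplitMono f, surjective_of_isSplitEpi f⟩

theorem epi_of_surjective (f : X ⟶ Y) (h : Function.Surjective f.hom.hom) : Epi f :=
  ⟨fun g₁ g₂ hg => by
    ext y
    obtain ⟨x, rfl⟩ := h y
    exact congrArg (fun q => q.hom.hom x) hg⟩

theorem mono_of_injective (f : X ⟶ Y) (h : Function.Injective f.hom.hom) : Mono f :=
  ⟨fun g₁ g₂ hg => by
    ext y
    exact h (congrArg (fun q => q.hom.hom y) hg)⟩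

theorem surjective_of_epi (f : X ⟶ Y) [Epi f] : Function.Surjective f.hom.hom := by
  let q : Y ⟶ FGModuleCat.of A (Y ⧸ LinearMap.range f.hom.hom) :=
    FGModuleCat.ofHom (LinearMap.range f.hom.hom).mkQ
  have hq : q = 0 := by
    rw [← cancel_epi f, Limits.comp_zero]
    ext x
    exact (Submodule.Quotient.mk_eq_zero _).2 ⟨x, rfl⟩
  intro y
  have h : q.hom.hom y = 0 := by rw [hq]; rfl
  exact (Submodule.Quotient.mk_eq_zero _).1 h

theorem injective_of_mono [IsNoetherianRing A] (f : X ⟶ Y) [Mono f] :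
    Function.Injective f.hom.hom := by
  let q : FGModuleCat.of A (LinearMap.ker f.hom.hom) ⟶ X :=
    FGModuleCat.ofHom (LinearMap.ker f.hom.hom).subtype
  have hq : q = 0 := by
    rw [← cancel_mono f, Limits.zero_comp]
    ext x
    exact x.2
  rw [← LinearMap.ker_eq_bot, eq_bot_iff]
  intro y hy
  have h : q.hom.hom ⟨y, hy⟩ = 0 := by rw [hq]; rfl
  exact h

/-- The morphism `A → X` with `1 ↦ x`. -/
def evalHom (X : FGModuleCat.{u} A) (x : X) : FGModuleCat.of A A ⟶ X :=
  FGModuleCat.ofHom (LinearMap.toSpanSingleton A X x)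

theorem evalHom_apply (x : X) (a : A) : (evalHom X x).hom.hom a = a • x := rfl

theorem evalHom_comp (x : X) (f : X ⟶ Y) : evalHom X x ≫ f = evalHom Y (f.hom.hom x) := by
  refine FGModuleCat.hom_ext (LinearMap.ext fun a => ?_)
  exact map_smul f.hom.hom a x

theorem eq_evalHom (f : FGModuleCat.of A A ⟶ X) : f = evalHom X (f.hom.hom (1 : A)) := by
  refine FGModuleCat.hom_ext (LinearMap.ext fun a => ?_)
  have := map_smul f.hom.hom a (1 : A)
  rw [smul_eq_mul, mul_one] at this
  exact this

end Modules

/-! ### Dimension count: units are epi, counits are mono -/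

section Dimension

open scoped ModuleCat.Algebra
open Module (finrank)

variable (k : Type v) {A : Type u} [Field k] [Ring A] [Algebra k A] [FiniteDimensional k A]

theorem finiteDimensional_fgModuleCat (X : FGModuleCat.{u} A) : FiniteDimensional k X :=
  Module.Finite.trans A X

omit [FiniteDimensional k A] in
theorem finrank_eq_of_iso {X Y : FGModuleCat.{u} A} (i : X ≅ Y) : finrank k X = finrank k Y :=
  ((FGModuleCat.isoToLinearEquiv i).restrictScalars k).finrank_eq

theorem epi_of_isSplitMono_of_finrank_le {X Y : FGModuleCat.{u} A} (f : X ⟶ Y) [IsSplitMono f]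
    (h : finrank k Y ≤ finrank k X) : Epi f := by
  have := finiteDimensional_fgModuleCat k X
  have := finiteDimensional_fgModuleCat k Y
  have hi : Function.Injective (f.hom.hom.restrictScalars k) := injective_of_isSplitMono f
  refine epi_of_surjective f ?_
  exact (LinearMap.injective_iff_surjective_of_finrank_eq_finrank
    (le_antisymm (LinearMap.finrank_le_finrank_of_injective hi) h)).1 hi

theorem mono_of_isSplitEpi_of_finrank_le {X Y : FGModuleCat.{u} A} (f : X ⟶ Y) [IsSplitEpi f]
    (h : finrank k X ≤ finrank k Y) : Mono f := by
  have := finiteDimensional_fgModuleCat k X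
  have := finiteDimensional_fgModuleCat k Y
  have hi : Function.Surjective (f.hom.hom.restrictScalars k) := surjective_of_isSplitEpi f
  refine mono_of_injective f ?_
  exact (LinearMap.injective_iff_surjective_of_finrank_eq_finrank
    (le_antisymm h (LinearMap.finrank_le_finrank_of_surjective hi))).2 hi

variable {F : FGModuleCat.{u} A ⥤ FGModuleCat.{u} A} (adj : F ⊣ F)

omit [FiniteDimensional k A] in
theorem finrank_functorPow_obj (n : ℕ) (X : FGModuleCat.{u} A) :
    finrank k ((functorPow F n).obj (F.obj (F.obj X))) =
      finrank k ((functorPow F (n + 2)).obj X) :=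
  finrank_eq_of_iso k (((functorPow_succ_iso F n).some.app (F.obj X)).symm ≪≫
    ((functorPow_succ_iso F (n + 1)).some.app X).symm)

include adj in
theorem finrank_functorPow_le (n : ℕ) (hn : 1 ≤ n) (X : FGModuleCat.{u} A) :
    finrank k ((functorPow F n).obj X) ≤ finrank k ((functorPow F (n + 2)).obj X) := by
  obtain ⟨n, rfl⟩ := Nat.exists_eq_add_of_le' hn
  rw [← finrank_functorPow_obj]
  have := isSplitMono_functorPow_map_unit adj n X
  have := finiteDimensional_fgModuleCat k
    ((functorPow F (n + 1)).obj (F.obj (F.obj X)))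
  exact LinearMap.finrank_le_finrank_of_injective
    (f := ((functorPow F (n + 1)).map (adj.unit.app X)).hom.hom.restrictScalars k)
    (injective_of_isSplitMono _)

include adj in
theorem finrank_functorPow_eq {m d : ℕ} (hm : 1 ≤ m) (hd : 1 ≤ d)
    (h : Nonempty (functorPow F (m + d) ≅ functorPow F m)) (X : FGModuleCat.{u} A) :
    finrank k ((functorPow F m).obj (F.obj (F.obj X))) = finrank k ((functorPow F m).obj X) := by
  rw [finrank_functorPow_obj]
  refine le_antisymm ?_ (finrank_functorPow_le k adj m hm X)
  have mono : ∀ j, finrank k ((functorPow F (m + 2)).obj X) ≤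
      finrank k ((functorPow F (m + 2 + 2 * j)).obj X) := by
    intro j
    induction j with
    | zero => exact le_rfl
    | succ j ih => exact ih.trans (finrank_functorPow_le k adj _ (by lia) X)
  have h2 := (functorPow_add_iso F h d).some ≪≫ h.some
  refine (mono (d - 1)).trans (le_of_eq ?_)
  -- Dimensions grow in steps of two, so the chain is closed after two periods, where the gap 2d is
  -- even.
  rw [show m + 2 + 2 * (d - 1) = m + d + d by lia]
  exact finrank_eq_of_iso k (h2.app X)

include k in
theorem epi_unit_app [F.Additive] {m d : ℕ} (hm : 1 ≤ m) (hd : 1 ≤ d)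
    (h : Nonempty (functorPow F (m + d) ≅ functorPow F m)) (X : FGModuleCat.{u} A) :
    Epi (adj.unit.app X) := by
  apply epi_unit_of_epi_map adj m
  have h1 := finrank_functorPow_eq k adj hm hd h X
  obtain ⟨n, rfl⟩ := Nat.exists_eq_add_of_le' hm
  have := isSplitMono_functorPow_map_unit adj n X
  exact epi_of_isSplitMono_of_finrank_le k _ h1.le

include k in
theorem mono_counit_app [F.Additive] {m d : ℕ} (hm : 1 ≤ m) (hd : 1 ≤ d)
    (h : Nonempty (functorPow F (m + d) ≅ functorPow F m)) (X : FGModuleCat.{u} A) :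
    Mono (adj.counit.app X) := by
  apply mono_counit_of_mono_map adj m
  have h1 := finrank_functorPow_eq k adj hm hd h X
  obtain ⟨n, rfl⟩ := Nat.exists_eq_add_of_le' hm
  have := isSplitEpi_functorPow_map_counit adj n X
  exact mono_of_isSplitEpi_of_finrank_le k _ h1.le

end Dimension

/-! ### The central idempotent of F² -/

section CentralIdempotent

variable {A : Type u} [Ring A] {F : FGModuleCat.{u} A ⥤ FGModuleCat.{u} A} (adj : F ⊣ F)

/-- If all counits are monomorphisms, then `F ∘ F` is isomorphic, via the counit, to the functor
`X ↦ e X` for a central idempotent `e`, which acts as the identity on all modules `F X`. -/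
theorem exists_central_idempotent (hε : ∀ X, Mono (adj.counit.app X)) :
    ∃ e : A, e * e = e ∧ (∀ a, a * e = e * a) ∧
      (∀ X, Function.Injective (adj.counit.app X).hom.hom) ∧
      (∀ (X : FGModuleCat.{u} A) (x : X),
        e • x = x ↔ ∃ y : F.obj (F.obj X), (adj.counit.app X).hom.hom y = x) ∧
      (∀ (X : FGModuleCat.{u} A) (y : F.obj X), e • y = y) := by
  have hi := isIso_counit_comp_unit adj hε
  -- A natural retraction of ε_X.
  let ρ (X : FGModuleCat.{u} A) : X ⟶ F.obj (F.obj X) :=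
    adj.unit.app X ≫ inv (adj.counit.app X ≫ adj.unit.app X)
  have hρ (X) : adj.counit.app X ≫ ρ X = 𝟙 _ := by
    simp only [ρ, ← Category.assoc]
    exact IsIso.hom_inv_id _
  have hρ' (X) (y) : (ρ X).hom.hom ((adj.counit.app X).hom.hom y) = y := by
    rw [← hom_comp_apply, hρ]; rfl
  have hnat {X Y : FGModuleCat.{u} A} (f : X ⟶ Y) : f ≫ ρ Y = ρ X ≫ F.map (F.map f) := by
    have h1 := adj.unit.naturality f
    have h2 := adj.counit.naturality f
    change f ≫ _ = _ ≫ F.map (F.map f) at h1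
    change F.map (F.map f) ≫ _ = _ ≫ f at h2
    simp only [ρ]
    rw [← Category.assoc, h1, Category.assoc, Category.assoc]
    congr 1
    rw [IsIso.eq_inv_comp, ← Category.assoc, IsIso.comp_inv_eq]
    rw [Category.assoc, ← h1, ← Category.assoc, ← h2, Category.assoc]
  clear_value ρ
  -- Retraction followed by counit is a natural idempotent endomorphism of the identity functor.
  -- Testing it on the maps A → X shows that it is multiplication by its value at 1.
  let e : A := (ρ (FGModuleCat.of A A) ≫ adj.counit.app (FGModuleCat.of A A)).hom.hom (1 : A)
  have he (X : FGModuleCat.{u} A) (x : X) : (ρ X ≫ adj.counit.app X).hom.hom x = e • x := by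
    have h1 : evalHom X x ≫ ρ X ≫ adj.counit.app X =
        (ρ (FGModuleCat.of A A) ≫ adj.counit.app (FGModuleCat.of A A)) ≫ evalHom X x := by
      have h2 := adj.counit.naturality (evalHom X x)
      change F.map (F.map _) ≫ _ = _ ≫ evalHom X x at h2
      rw [← Category.assoc, hnat, Category.assoc, h2, ← Category.assoc]
    have h3 := congrArg (fun q => q.hom.hom (1 : A)) h1
    rw [hom_comp_apply, hom_comp_apply, evalHom_apply, one_smul] at h3
    exact h3
  have hfix (X : FGModuleCat.{u} A) (x : X) :
      e • x = x ↔ ∃ y : F.obj (F.obj X), (adj.counit.app X).hom.hom y = x := by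
    rw [← he]
    constructor
    · exact fun h => ⟨_, h⟩
    · rintro ⟨y, rfl⟩
      rw [hom_comp_apply, hρ']
  refine ⟨e, ?_, ?_, fun X => ?_, hfix, fun X y => ?_⟩
  · exact (hfix (FGModuleCat.of A A) e).2 ⟨_, rfl⟩
  · intro a
    have h1 := he (FGModuleCat.of A A) a
    have h2 := map_smul (ρ (FGModuleCat.of A A) ≫ adj.counit.app (FGModuleCat.of A A)).hom.hom a
      (1 : A)
    rw [smul_eq_mul, mul_one] at h2
    exact h2.symm.trans h1
  · exact Function.LeftInverse.injective (hρ' X)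
  · have h1 := isIso_unit_obj adj hε X
    have h2 : IsIso (adj.counit.app (F.obj X)) :=
      IsIso.of_isIso_comp_right _ (adj.unit.app (F.obj X))
    exact (hfix _ _).2 ((bijective_of_isIso (adj.counit.app (F.obj X))).2 y)

end CentralIdempotent

/-! ### F on simple modules, and a generator of FA -/

section Basic

open scoped ModuleCat.Algebra
open Module (finrank)

variable {k : Type v} {A : Type u} [Field k] [Ring A] [Algebra k A]

theorem exists_character (L : FGModuleCat.{u} A) (hL : finrank k L = 1) :
    ∃ χ : A →ₐ[k] k, ∀ (a : A) (x : L), a • x = χ a • x := by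
  have : Nontrivial L := Module.nontrivial_of_finrank_pos (R := k) (by lia)
  have : FiniteDimensional k L := Module.finite_of_finrank_eq_succ hL
  let ι : k →ₐ[k] Module.End k L := Algebra.ofId k _
  have hι : Function.Bijective ι :=
    (LinearMap.injective_iff_surjective_of_finrank_eq_finrank (f := ι.toLinearMap)
      (by rw [Module.finrank_self, Module.finrank_linearMap, hL])) |>.1 ι.toRingHom.injective |>
      fun h => ⟨ι.toRingHom.injective, h⟩
  let ψ := AlgEquiv.ofBijective ι hι
  refine ⟨(ψ.symm : Module.End k L →ₐ[k] k).comp (Algebra.lsmul k k L), fun a x => ?_⟩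
  have h : ψ (ψ.symm (Algebra.lsmul k k L a)) = Algebra.lsmul k k L a := ψ.apply_symm_apply _
  exact (congrArg (fun f : Module.End k L => f x) h).symm

variable [FiniteDimensional k A] {F : FGModuleCat.{u} A ⥤ FGModuleCat.{u} A} [F.Additive]
  (adj : F ⊣ F)

include adj in
-- FL is zero or simple. A nonzero map FL → V has a nonzero transpose L → FV, which is mono because
-- L is simple; applying F and composing with the mono ε_V recovers the original map, so that map is
-- mono as well.
theorem finrank_obj_le_one (hA : IsBasicAlgebra k A) (hε : ∀ X, Mono (adj.counit.app X))
    (L : FGModuleCat.{u} A) [IsSimpleModule A L] : finrank k (F.obj L) ≤ 1 := by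
  have : IsNoetherianRing A := isNoetherian_of_tower k inferInstance
  by_cases hn : Nontrivial (F.obj L)
  swap
  · rw [not_nontrivial_iff_subsingleton] at hn
    rw [Module.finrank_zero_of_subsingleton]
    exact zero_le_one
  have hs : IsSimpleModule A (F.obj L) := by
    rw [isSimpleModule_iff]
    refine { exists_pair_ne := exists_pair_ne _, eq_bot_or_eq_top := fun U => ?_ }
    by_contra! hU
    let V : FGModuleCat.{u} A := FGModuleCat.of A (F.obj L ⧸ U)
    let f : F.obj L ⟶ V := FGModuleCat.ofHom U.mkQ
    have hf : f ≠ 0 := by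
      intro h
      apply hU.2
      rw [← U.ker_mkQ, LinearMap.ker_eq_top]
      exact congrArg (fun q => q.hom.hom) h
    let g := adj.homEquiv L V f
    have hg : g.hom.hom ≠ 0 := by
      intro h
      apply hf
      apply (adj.homEquiv L V).injective
      refine (FGModuleCat.hom_ext h : g = 0).trans ?_
      rw [adj.homEquiv_unit, F.map_zero, Limits.comp_zero]
    have h1 : Mono g := mono_of_injective _ ((LinearMap.injective_or_eq_zero _).resolve_right hg)
    have h2 : f = F.map g ≫ adj.counit.app V := by
      exact ((adj.homEquiv L V).symm_apply_apply f).symm.trans (adj.homEquiv_counit _ _ _)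
    have := hε V
    have := adj.isRightAdjoint
    have h3 : Mono f := by
      rw [h2]
      exact mono_comp (F.map g) _
    apply hU.1
    rw [← U.ker_mkQ]
    exact LinearMap.ker_eq_bot.2 (injective_of_mono f)
  exact (hA (F.obj L) hs).le

include adj in
-- A maximal submodule N of FA is determined by the character of A on FA/N, because Hom(FA, FA/N) ≅
-- F(FA/N) is at most one-dimensional. A finite dimensional algebra has finitely many characters.
theorem finite_coatoms [F.Linear k] (hA : IsBasicAlgebra k A)
    (hε : ∀ X, Mono (adj.counit.app X)) :
    {N : Submodule A (F.obj (FGModuleCat.of A A)) | IsCoatom N}.Finite := by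
  let P := F.obj (FGModuleCat.of A A)
  let Q (N : Submodule A P) : FGModuleCat.{u} A := FGModuleCat.of A (P ⧸ N)
  have hs (N : {N : Submodule A P | IsCoatom N}) : IsSimpleModule A (Q N) :=
    isSimpleModule_iff_isCoatom.2 N.2
  have h1 (N : {N : Submodule A P | IsCoatom N}) : finrank k (Q N) = 1 := hA (Q N) (hs N)
  choose χ hχ using fun N => exists_character (Q (N : {N : Submodule A P | IsCoatom N})) (h1 N)
  suffices h : Function.Injective χ from
    have : Finite {N : Submodule A P | IsCoatom N} := Finite.of_injective χ h
    Set.toFinite _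
  intro N N' hN
  have := hs N
  have hd := finrank_obj_le_one (k := k) adj hA hε (Q N)
  let g : Q N' ≃ₗ[k] Q N :=
    have := Module.finite_of_finrank_eq_succ (h1 N)
    have := Module.finite_of_finrank_eq_succ (h1 N')
    LinearEquiv.ofFinrankEq _ _ ((h1 N').trans (h1 N).symm)
  let gA : Q N' →ₗ[A] Q N :=
    { toFun := g
      map_add' := map_add g
      map_smul' := fun a x => by
        rw [hχ, ← hN, map_smul, RingHom.id_apply, hχ] }
  let f : P ⟶ Q N := FGModuleCat.ofHom (N : Submodule A P).mkQ
  let f' : P ⟶ Q N := FGModuleCat.ofHom (gA ∘ₗ (N' : Submodule A P).mkQ)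
  let t : FGModuleCat.of A A ⟶ F.obj (Q N) := adj.homEquiv _ _ f
  let t' : FGModuleCat.of A A ⟶ F.obj (Q N) := adj.homEquiv _ _ f'
  have ht : t.hom.hom (1 : A) ≠ 0 := by
    intro h
    have h0 : t = 0 := by
      rw [eq_evalHom t, h]
      ext
      exact smul_zero _
    have hf : f = 0 := by
      apply (adj.homEquiv _ _).injective
      refine h0.trans ?_
      rw [adj.homEquiv_unit, F.map_zero, Limits.comp_zero]
    apply N.2.1
    rw [← (N : Submodule A P).ker_mkQ, LinearMap.ker_eq_top]
    exact congrArg (fun q => q.hom.hom) hf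
  have := finiteDimensional_fgModuleCat k (F.obj (Q N))
  have hd1 : finrank k (F.obj (Q N)) = 1 :=
    le_antisymm hd (Module.finrank_pos_iff_exists_ne_zero.2 ⟨_, ht⟩)
  obtain ⟨c, hc⟩ := exists_smul_eq_of_finrank_eq_one hd1 ht (t'.hom.hom (1 : A))
  have htt : t' = c • t := by
    rw [eq_evalHom t', ← hc]
    exact (eq_evalHom (c • t)).symm
  have hff : f' = c • f := by
    have e1 : f' = F.map t' ≫ adj.counit.app (Q N) :=
      ((adj.homEquiv _ _).symm_apply_apply f').symm.trans (adj.homEquiv_counit _ _ _)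
    have e2 : f = F.map t ≫ adj.counit.app (Q N) :=
      ((adj.homEquiv _ _).symm_apply_apply f).symm.trans (adj.homEquiv_counit _ _ _)
    rw [e1, e2, htt, F.map_smul]
    exact Linear.smul_comp _ _ _ _ _ _
  have hle : (N : Submodule A P) ≤ N' := by
    intro x hx
    have h2 : f.hom.hom x = 0 := (Submodule.Quotient.mk_eq_zero _).2 hx
    have h3 : f'.hom.hom x = c • f.hom.hom x := congrArg (fun q => q.hom.hom x) hff
    rw [h2, smul_zero] at h3
    have h4 : (N' : Submodule A P).mkQ x = 0 := g.injective (h3.trans (map_zero g).symm)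
    exact (Submodule.Quotient.mk_eq_zero _).1 h4
  exact Subtype.ext (hle.eq_or_lt.resolve_right fun hlt => N'.2.1 (N.2.2 _ hlt))

include adj in
/-- For a basic algebra `A` the module `F A` is cyclic. -/
theorem exists_span_singleton_eq_top [F.Linear k] [Infinite k] (hA : IsBasicAlgebra k A)
    (hε : ∀ X, Mono (adj.counit.app X)) :
    ∃ t : F.obj (FGModuleCat.of A A), Submodule.span A {t} = ⊤ := by
  let P := F.obj (FGModuleCat.of A A)
  have hfin := finite_coatoms (k := k) adj hA hε
  classical
  -- A vector space over an infinite field is not a finite union of proper subspaces; a vector in no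
  -- maximal submodule generates.
  let s : Finset (Subspace k P) := hfin.toFinset.image fun N => N.restrictScalars k
  have hs : ⊤ ∉ s := by
    intro h
    obtain ⟨N, hN, h⟩ := Finset.mem_image.1 h
    exact (hfin.mem_toFinset.1 hN).1 ((Submodule.restrictScalars_eq_top_iff _ _ _).1 h)
  have h1 := Subspace.biUnion_ne_univ_of_top_notMem hs
  obtain ⟨t, ht⟩ := (Set.ne_univ_iff_exists_notMem _).1 h1
  refine ⟨t, ?_⟩
  by_contra h
  obtain ⟨N, hN, hle⟩ := (eq_top_or_exists_le_coatom (Submodule.span A {t})).resolve_left h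
  refine ht (Set.mem_biUnion (x := N.restrictScalars k) ?_ ?_)
  · exact Finset.mem_image_of_mem _ (hfin.mem_toFinset.2 hN)
  · exact hle (Submodule.mem_span_singleton_self t)

include k in
omit [F.Additive] in
/-- The annihilator of a generator of `F A`. -/
theorem smul_eq_zero_iff_of_span_eq_top {e : A} (hee : e * e = e)
    (hce : ∀ a, a * e = e * a)
    (hfix : ∀ (X : FGModuleCat.{u} A) (x : X),
      e • x = x ↔ ∃ y : F.obj (F.obj X), (adj.counit.app X).hom.hom y = x)
    (hid : ∀ (X : FGModuleCat.{u} A) (y : F.obj X), e • y = y)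
    {t : F.obj (FGModuleCat.of A A)} (ht : Submodule.span A {t} = ⊤) (a : A) :
    a • t = 0 ↔ a * e = 0 := by
  let P := F.obj (FGModuleCat.of A A)
  have := finiteDimensional_fgModuleCat k P
  have := finiteDimensional_fgModuleCat k (F.obj P)
  -- The counit has image Ae, and et = t, so `f` is onto. Applying F to the surjection A → P gives
  -- dim FP ≤ dim P, so `f` is bijective, which forces a ↦ at to be injective on Ae.
  let f : F.obj P ⟶ P := adj.counit.app (FGModuleCat.of A A) ≫ evalHom P t
  have hsurj : Function.Surjective (evalHom P t).hom.hom := by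
    intro y
    have hy : y ∈ Submodule.span A {t} := by rw [ht]; trivial
    obtain ⟨b, hb⟩ := Submodule.mem_span_singleton.1 hy
    exact ⟨b, hb⟩
  have het (b : A) : (b * e) • t = b • t := by rw [mul_smul, hid]
  have hlift (b : A) : ∃ z, (adj.counit.app (FGModuleCat.of A A)).hom.hom z = b * e :=
    (hfix (FGModuleCat.of A A) (b * e)).1 (by
      change e * (b * e) = b * e
      rw [← hce, mul_assoc, hee])
  have hf : Function.Surjective (f.hom.hom.restrictScalars k) := by
    intro y
    obtain ⟨b, rfl⟩ := hsurj y
    obtain ⟨z, hz⟩ := hlift b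
    exact ⟨z, (congrArg (fun x : A => x • t) hz).trans (het b)⟩
  have hle : finrank k (F.obj P) ≤ finrank k P := by
    have := epi_of_surjective _ hsurj
    have := adj.isLeftAdjoint
    have hs := surjective_of_epi (F.map (evalHom P t))
    exact LinearMap.finrank_le_finrank_of_surjective
      (f := (F.map (evalHom P t)).hom.hom.restrictScalars k) hs
  have hfinj : Function.Injective (f.hom.hom.restrictScalars k) :=
    (LinearMap.injective_iff_surjective_of_finrank_eq_finrank
      (le_antisymm hle (LinearMap.finrank_le_finrank_of_surjective hf))).2 hf
  constructor
  · intro h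
    obtain ⟨z, hz⟩ := hlift a
    have h0 : f.hom.hom z = f.hom.hom 0 := by
      rw [map_zero]
      exact (congrArg (fun x : A => x • t) hz).trans ((het a).trans h)
    rw [← hz, hfinj h0]
    exact map_zero (adj.counit.app (FGModuleCat.of A A)).hom.hom
  · intro h
    rw [← het, h, zero_smul]

end Basic

/-! ### Twist data and their multiplicativity -/

section Twisting

variable {k : Type v} {A : Type u} [Field k] [Ring A] [Algebra k A]
  {F : FGModuleCat.{u} A ⥤ FGModuleCat.{u} A}

/-- An identification of `F` with `M ↦ e M`, where `a` acts on `e M` by `c a`. -/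
structure TwistData (F : FGModuleCat.{u} A ⥤ FGModuleCat.{u} A) (e : A) where
  /-- The twist. -/
  c : A → A
  /-- The embedding of `F M` into `M`. -/
  α (M : FGModuleCat.{u} A) : F.obj M →+ M
  naturality {M N : FGModuleCat.{u} A} (f : M ⟶ N) (x : F.obj M) :
    α N ((F.map f).hom.hom x) = f.hom.hom (α M x)
  injective (M : FGModuleCat.{u} A) : Function.Injective (α M)
  smul_eq_iff (M : FGModuleCat.{u} A) (m : M) : e • m = m ↔ ∃ x, α M x = m
  α_smul (M : FGModuleCat.{u} A) (a : A) (x : F.obj M) : α M (a • x) = c a • α M x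
  mul_e (a : A) : c a * e = c a

namespace TwistData

variable {e : A} (D : TwistData F e)

include D in
theorem exists_α_eq (hee : e * e = e) : ∃ x, D.α (FGModuleCat.of A A) x = e :=
  (D.smul_eq_iff (FGModuleCat.of A A) e).1 hee

/-- Evaluating at the element that `α` sends to e pins down the twist, thanks to the normalisation
`mul_e`. All algebraic properties of `c` follow from this uniqueness. -/
theorem c_eq_of_forall (hee : e * e = e) {a b : A} (hb : b * e = b)
    (h : ∀ x : F.obj (FGModuleCat.of A A), D.α _ (a • x) = b • D.α _ x) : D.c a = b := by
  obtain ⟨x, hx⟩ := D.exists_α_eq hee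
  have h1 := h x
  rw [D.α_smul, hx] at h1
  exact (D.mul_e a).symm.trans (h1.trans hb)

theorem c_mul (hee : e * e = e) (a b : A) : D.c (a * b) = D.c a * D.c b := by
  refine D.c_eq_of_forall hee (by rw [mul_assoc, D.mul_e]) fun x => ?_
  rw [mul_smul, D.α_smul, D.α_smul, mul_smul]

theorem c_add (hee : e * e = e) (a b : A) : D.c (a + b) = D.c a + D.c b := by
  refine D.c_eq_of_forall hee (by rw [add_mul, D.mul_e, D.mul_e]) fun x => ?_
  rw [add_smul, map_add, D.α_smul, D.α_smul, add_smul]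

theorem c_zero (hee : e * e = e) : D.c 0 = 0 := by
  refine D.c_eq_of_forall hee (zero_mul e) fun x => ?_
  rw [zero_smul, zero_smul, map_zero]

theorem e_smul_α (M : FGModuleCat.{u} A) (x : F.obj M) : e • D.α M x = D.α M x :=
  (D.smul_eq_iff M _).2 ⟨x, rfl⟩

theorem c_one (hee : e * e = e) : D.c 1 = e := by
  refine D.c_eq_of_forall hee hee fun x => ?_
  rw [one_smul, D.e_smul_α]

theorem c_e (hee : e * e = e) (hid : ∀ (X : FGModuleCat.{u} A) (y : F.obj X), e • y = y) :
    D.c e = e := by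
  refine D.c_eq_of_forall hee hee fun x => ?_
  rw [hid, D.e_smul_α]

theorem c_eq_zero_of_mul_eq_zero (hee : e * e = e)
    (hid : ∀ (X : FGModuleCat.{u} A) (y : F.obj X), e • y = y) {a : A} (ha : a * e = 0) :
    D.c a = 0 := by
  calc D.c a = D.c a * e := (D.mul_e a).symm
    _ = D.c a * D.c e := by rw [D.c_e hee hid]
    _ = 0 := by rw [← D.c_mul hee, ha, D.c_zero hee]

end TwistData

end Twisting

/-! ### Construction of the twist from a generator of FA -/

section Construction

open scoped ModuleCat.Algebra

variable {k : Type v} {A : Type u} [Field k] [Ring A] [Algebra k A]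
  {F : FGModuleCat.{u} A ⥤ FGModuleCat.{u} A} [F.Additive] (adj : F ⊣ F) {e : A}

theorem exists_hom_of_generator {P M : FGModuleCat.{u} A} {t : P}
    (ht : Submodule.span A {t} = ⊤) (m : M) (h : ∀ a : A, a • t = 0 → a • m = 0) :
    ∃ g : P ⟶ M, g.hom.hom t = m := by
  let p := LinearMap.toSpanSingleton A P t
  have hp : Function.Surjective p := by
    rw [← LinearMap.range_eq_top, LinearMap.range_toSpanSingleton, ht]
  let g := (LinearMap.ker p).liftQ (LinearMap.toSpanSingleton A M m) (fun a ha => h a ha) ∘ₗ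
    (p.quotKerEquivOfSurjective hp).symm.toLinearMap
  refine ⟨FGModuleCat.ofHom g, ?_⟩
  have h1 : (p.quotKerEquivOfSurjective hp).symm t = Submodule.Quotient.mk (1 : A) := by
    rw [LinearEquiv.symm_apply_eq]
    exact (one_smul A t).symm
  change (LinearMap.ker p).liftQ (LinearMap.toSpanSingleton A M m) (fun a ha => h a ha)
    ((p.quotKerEquivOfSurjective hp).symm t) = m
  rw [h1]
  exact one_smul A m

theorem hom_ext_of_generator {P M : FGModuleCat.{u} A} {t : P}
    (ht : Submodule.span A {t} = ⊤) {g g' : P ⟶ M} (h : g.hom.hom t = g'.hom.hom t) : g = g' :=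
  FGModuleCat.hom_ext (LinearMap.ext_on ht (by
    rintro _ rfl
    exact h))

include adj in
theorem exists_twistData (hee : e * e = e)
    (hid : ∀ (X : FGModuleCat.{u} A) (y : F.obj X), e • y = y)
    {t : F.obj (FGModuleCat.of A A)} (ht : Submodule.span A {t} = ⊤)
    (hann : ∀ a : A, a • t = 0 ↔ a * e = 0) :
    ∃ D : TwistData F e, ∀ a : A,
      (F.map (evalHom (FGModuleCat.of A A) a)).hom.hom t = D.c a • t := by
  have hgen (y : F.obj (FGModuleCat.of A A)) : ∃ b : A, b * e = b ∧ b • t = y := by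
    have hy : y ∈ Submodule.span A {t} := by rw [ht]; trivial
    obtain ⟨b, rfl⟩ := Submodule.mem_span_singleton.1 hy
    exact ⟨b * e, by rw [mul_assoc, hee], by rw [mul_smul, hid]⟩
  choose c hc1 hc2 using fun a : A => hgen ((F.map (evalHom (FGModuleCat.of A A) a)).hom.hom t)
  have hadj {M : FGModuleCat.{u} A} (g : F.obj (FGModuleCat.of A A) ⟶ M) :
      F.map (evalHom (F.obj M) ((adj.homEquiv _ _ g).hom.hom (1 : A))) ≫ adj.counit.app M = g := by
    rw [← eq_evalHom]
    exact (adj.homEquiv_counit _ _ _).symm.trans ((adj.homEquiv _ _).symm_apply_apply g)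
  -- View x as a map A → FM, transpose it to FA → M, and evaluate at `t`. Since `t` generates, this
  -- is injective; since `t` and e have the same annihilator, the image is eM.
  let α (M : FGModuleCat.{u} A) (x : F.obj M) : M :=
    (F.map (evalHom (F.obj M) x) ≫ adj.counit.app M).hom.hom t
  have hα0 (M : FGModuleCat.{u} A) (x : F.obj M) (h : α M x = 0) : x = 0 := by
    have h1 : F.map (evalHom (F.obj M) x) ≫ adj.counit.app M = 0 :=
      hom_ext_of_generator ht h
    have h2 : evalHom (F.obj M) x = 0 := by
      apply (adj.homEquiv _ _).symm.injective
      refine ((adj.homEquiv_counit _ _ _).trans h1).trans ?_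
      rw [adj.homEquiv_counit, F.map_zero, Limits.zero_comp]
    have h3 := evalHom_apply x (1 : A)
    rw [h2, one_smul] at h3
    exact h3.symm
  have hαadd (M : FGModuleCat.{u} A) (x y : F.obj M) : α M (x + y) = α M x + α M y := by
    have h1 : evalHom (F.obj M) (x + y) = evalHom (F.obj M) x + evalHom (F.obj M) y :=
      FGModuleCat.hom_ext (LinearMap.ext fun a => smul_add a x y)
    simp only [α]
    rw [h1, F.map_add, Preadditive.add_comp]
    rfl
  refine ⟨⟨c, fun M => AddMonoidHom.mk' (α M) (hαadd M), ?_, ?_, ?_, ?_, hc1⟩,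
    fun a => (hc2 a).symm⟩
  · intro M N f x
    change α N _ = f.hom.hom (α M x)
    simp only [α]
    rw [← evalHom_comp, F.map_comp, Category.assoc]
    have h1 := adj.counit.naturality f
    change F.map (F.map f) ≫ _ = _ ≫ f at h1
    rw [h1]
    rfl
  · intro M
    rw [injective_iff_map_eq_zero]
    exact hα0 M
  · intro M m
    constructor
    · intro hm
      obtain ⟨g, hg⟩ := exists_hom_of_generator ht m fun a ha => by
        rw [← hm, ← mul_smul, (hann a).1 ha, zero_smul]
      exact ⟨_, (congrArg (fun q => q.hom.hom t) (hadj g)).trans hg⟩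
    · rintro ⟨x, rfl⟩
      change e • α M x = α M x
      simp only [α]
      rw [← map_smul, hid]
  · intro M a x
    change α M (a • x) = c a • α M x
    have h1 : evalHom (F.obj M) (a • x) =
        evalHom (FGModuleCat.of A A) a ≫ evalHom (F.obj M) x := by
      rw [evalHom_comp, evalHom_apply]
    simp only [α]
    rw [h1, F.map_comp, Category.assoc, hom_comp_apply, ← hc2, map_smul]

omit [F.Additive] in
theorem TwistData.c_algebraMap [F.Linear k] (D : TwistData F e) (hee : e * e = e) (r : k) :
    D.c (algebraMap k A r) = algebraMap k A r * e := by
  refine D.c_eq_of_forall hee (by rw [mul_assoc, hee]) fun x => ?_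
  have h1 : (F.map (r • 𝟙 (FGModuleCat.of A A))).hom.hom x = algebraMap k A r • x := by
    rw [F.map_smul, F.map_id]
    rfl
  rw [← h1, D.naturality, mul_smul, D.e_smul_α]
  rfl

/-- If c(a) = 0, then F kills right multiplication by a. So does F², and F² computes this
multiplication on Ae through the counit. -/
theorem TwistData.mul_eq_zero_of_c_eq_zero (hce : ∀ a, a * e = e * a) (hee : e * e = e)
    (hfix : ∀ (X : FGModuleCat.{u} A) (x : X),
      e • x = x ↔ ∃ y : F.obj (F.obj X), (adj.counit.app X).hom.hom y = x)
    {t : F.obj (FGModuleCat.of A A)} (ht : Submodule.span A {t} = ⊤) (D : TwistData F e)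
    (hD : ∀ a : A, (F.map (evalHom (FGModuleCat.of A A) a)).hom.hom t = D.c a • t)
    {a : A} (ha : D.c a = 0) : a * e = 0 := by
  have h1 : F.map (evalHom (FGModuleCat.of A A) a) = 0 :=
    hom_ext_of_generator ht (by rw [hD, ha, zero_smul]; rfl)
  have h2 := adj.counit.naturality (evalHom (FGModuleCat.of A A) a)
  change F.map (F.map _) ≫ _ = _ ≫ evalHom (FGModuleCat.of A A) a at h2
  rw [h1, F.map_zero, Limits.zero_comp] at h2
  obtain ⟨y, hy⟩ := (hfix (FGModuleCat.of A A) e).1 hee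
  have h3 := congrArg (fun q => q.hom.hom y) h2
  rw [hce]
  refine Eq.trans ?_ h3.symm
  rw [hom_comp_apply, hy]
  rfl

omit [F.Additive] in
-- Both ε and the twice iterated `α` embed F²A in A with image Ae. The first is A-linear, the second
-- is linear up to c∘c, and both are natural for right multiplications; s is the image under the
-- second of the element u that ε sends to e.
theorem TwistData.exists_inner (hce : ∀ a, a * e = e * a) (hee : e * e = e)
    (hinj : ∀ X, Function.Injective (adj.counit.app X).hom.hom)
    (hfix : ∀ (X : FGModuleCat.{u} A) (x : X),
      e • x = x ↔ ∃ y : F.obj (F.obj X), (adj.counit.app X).hom.hom y = x)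
    (hid : ∀ (X : FGModuleCat.{u} A) (y : F.obj X), e • y = y) (D : TwistData F e) :
    ∃ s : A, (∀ a, s * a = D.c (D.c a) * s) ∧ ∃ a, s * a = e := by
  let R := FGModuleCat.of A A
  let β (z : F.obj (F.obj R)) : A := D.α R (D.α (F.obj R) z)
  obtain ⟨u, hu⟩ := (hfix R e).1 hee
  have hβ (a : A) (z) : β (a • z) = D.c (D.c a) * β z := by
    simp only [β]
    rw [D.α_smul, D.α_smul]
    rfl
  have hau (a : A) : (F.map (F.map (evalHom R a))).hom.hom u = a • u := by
    apply hinj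
    have h2 := adj.counit.naturality (evalHom R a)
    change F.map (F.map _) ≫ _ = _ ≫ evalHom R a at h2
    rw [map_smul, ← hom_comp_apply, h2, hom_comp_apply, hu]
    exact (hce a).symm
  have hs (a : A) : β (a • u) = β u * a := by
    rw [← hau]
    simp only [β]
    rw [D.naturality, D.naturality]
    rfl
  refine ⟨β u, fun a => by rw [← hs, hβ], ?_⟩
  obtain ⟨x, hx⟩ := D.exists_α_eq hee
  obtain ⟨z, hz⟩ := (D.smul_eq_iff _ x).1 (hid _ x)
  obtain ⟨a, ha⟩ : ∃ a : A, a • u = z := by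
    refine ⟨(adj.counit.app R).hom.hom z, hinj _ ?_⟩
    rw [map_smul, hu]
    refine (hce _).trans ?_
    exact (hfix R _).2 ⟨z, rfl⟩
  refine ⟨a, ?_⟩
  rw [← hs, ha]
  simp only [β]
  rw [hz, hx]

end Construction

/-! ### Splitting the algebra, and the induced automorphism -/

section Quotient

variable {k : Type v} {A : Type u} [Field k] [Ring A] [Algebra k A]

variable (k) in
/-- The quotient of `A` by the annihilator of a central element. -/
theorem exists_quotient_of_central {e : A} (hce : ∀ a, a * e = e * a) :
    ∃ (B : Type u) (_ : Ring B) (_ : Algebra k B) (p : A →ₐ[k] B),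
      Function.Surjective p ∧ ∀ a, p a = 0 ↔ a * e = 0 := by
  let I : Ideal A := LinearMap.ker (LinearMap.toSpanSingleton A A e)
  have hI (a : A) : a ∈ I ↔ a * e = 0 := Iff.rfl
  have : I.IsTwoSided := ⟨fun {a} b ha => by
    rw [hI] at ha ⊢
    rw [mul_assoc, hce, ← mul_assoc, ha, zero_mul]⟩
  exact ⟨A ⧸ I, inferInstance, inferInstance, Ideal.Quotient.mkₐ k I,
    Ideal.Quotient.mkₐ_surjective k I, fun a => Ideal.Quotient.eq_zero_iff_mem.trans (hI a)⟩

theorem exists_algEquiv_prod {e : A} (hee : e * e = e)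
    {B C : Type u} [Ring B] [Ring C] [Algebra k B] [Algebra k C]
    {p : A →ₐ[k] B} {q : A →ₐ[k] C} (hp : Function.Surjective p) (hq : Function.Surjective q)
    (hp0 : ∀ a, p a = 0 ↔ a * e = 0) (hq0 : ∀ a, q a = 0 ↔ a * (1 - e) = 0) :
    ∃ E : A ≃ₐ[k] B × C, ∀ a, E a = (p a, q a) := by
  have hpe : p e = 1 := by
    rw [← sub_eq_zero, ← map_one p, ← map_sub, hp0, sub_mul, hee, one_mul, sub_self]
  have hqe : q e = 0 := by rw [hq0, mul_sub, mul_one, hee, sub_self]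
  refine ⟨AlgEquiv.ofBijective (p.prod q) ⟨?_, ?_⟩, fun a => rfl⟩
  · rw [injective_iff_map_eq_zero]
    intro a ha
    have h1 := (hp0 a).1 (congrArg Prod.fst ha)
    have h2 := (hq0 a).1 (congrArg Prod.snd ha)
    rwa [mul_sub, h1, sub_zero, mul_one] at h2
  · rintro ⟨b, c⟩
    obtain ⟨b, rfl⟩ := hp b
    obtain ⟨c, rfl⟩ := hq c
    refine ⟨b * e + c * (1 - e), Prod.ext ?_ ?_⟩
    · change p _ = p b
      simp [hpe]
    · change q _ = q c
      simp [hqe]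

/-- The automorphism of the quotient `B` induced by twist data. -/
theorem TwistData.exists_algEquiv {F : FGModuleCat.{u} A ⥤ FGModuleCat.{u} A} [F.Linear k]
    [FiniteDimensional k A] {e : A} (D : TwistData F e) (hee : e * e = e)
    (hid : ∀ (X : FGModuleCat.{u} A) (y : F.obj X), e • y = y)
    (hc0 : ∀ a, D.c a = 0 → a * e = 0)
    {B : Type u} [Ring B] [Algebra k B] {p : A →ₐ[k] B} (hp : Function.Surjective p)
    (hp0 : ∀ a, p a = 0 ↔ a * e = 0) :
    ∃ φ : B ≃ₐ[k] B, ∀ a, φ (p a) = p (D.c a) := by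
  have hpe : p e = 1 := by
    rw [← sub_eq_zero, ← map_one p, ← map_sub, hp0, sub_mul, hee, one_mul, sub_self]
  let ψ : A →ₐ[k] B :=
    { toFun := fun a => p (D.c a)
      map_one' := by rw [D.c_one hee, hpe]
      map_mul' := fun a b => by rw [D.c_mul hee, map_mul]
      map_zero' := by rw [D.c_zero hee, map_zero]
      map_add' := fun a b => by rw [D.c_add hee, map_add]
      commutes' := fun r => by rw [D.c_algebraMap hee, map_mul, hpe, mul_one, AlgHom.commutes] }
  have hker (a : A) : ψ a = 0 ↔ p a = 0 := by
    rw [hp0]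
    refine ⟨fun h => hc0 a ?_, fun h => ?_⟩
    · have h1 := (hp0 _).1 h
      rwa [D.mul_e] at h1
    · change p (D.c a) = 0
      rw [D.c_eq_zero_of_mul_eq_zero hee hid h, map_zero]
  let σ := Function.surjInv hp
  -- As ψ and p have the same kernel, ψ factors through p by an injective endomorphism of B, which
  -- is bijective by finite dimension.
  have hφ (a : A) : ψ (σ (p a)) = ψ a := by
    rw [← sub_eq_zero, ← map_sub, hker, map_sub, sub_eq_zero]
    exact Function.surjInv_eq hp (p a)
  let φ : B →ₐ[k] B :=
    { toFun := fun b => ψ (σ b)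
      map_one' := by rw [← map_one p, hφ, map_one, map_one]
      map_mul' := fun x y => by
        obtain ⟨a, rfl⟩ := hp x
        obtain ⟨b, rfl⟩ := hp y
        rw [← map_mul, hφ, hφ, hφ, map_mul]
      map_zero' := by rw [← map_zero p, hφ, map_zero, map_zero]
      map_add' := fun x y => by
        obtain ⟨a, rfl⟩ := hp x
        obtain ⟨b, rfl⟩ := hp y
        rw [← map_add, hφ, hφ, hφ, map_add]
      commutes' := fun r => by rw [← p.commutes, hφ, AlgHom.commutes, AlgHom.commutes] }
  have : FiniteDimensional k B := Module.Finite.of_surjective p.toLinearMap hp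
  have hinj : Function.Injective φ := by
    rw [injective_iff_map_eq_zero]
    intro b hb
    obtain ⟨a, rfl⟩ := hp b
    exact (hker a).1 ((hφ a).symm.trans hb)
  exact ⟨AlgEquiv.ofBijective φ ⟨hinj, LinearMap.injective_iff_surjective.1
    (show Function.Injective φ.toLinearMap from hinj)⟩, hφ⟩

/-- The intertwining relation turns the right inverse t into the left inverse φ(t). -/
theorem isInnerAut_of_mul_eq {B : Type u} [Ring B] [Algebra k B] (φ : B ≃ₐ[k] B) {s t : B}
    (h : ∀ b, s * b = φ b * s) (hst : s * t = 1) : IsInnerAut φ := by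
  obtain ⟨t', ht'⟩ : ∃ t', t' * s = 1 := ⟨φ t, by rw [← h, hst]⟩
  have htt : t' = t := left_inv_eq_right_inv ht' hst
  refine ⟨⟨s, t, hst, htt ▸ ht'⟩, fun b => ?_⟩
  change φ b = s * b * t
  rw [h, mul_assoc, hst, mul_one]

end Quotient

/-! ### The twisted tensor product as a twisted module -/

section TwistedTensor

variable {k : Type v} [Field k] {B : Type u} [Ring B] [Algebra k B] (φ : B ≃ₐ[k] B)
  (N : Type u) [AddCommGroup N] [Module B N]

/-- The map `n ↦ 1 ⊗ n`. -/
def oneTensor : N →+ BalancedTensor B B (TwistedBimodule φ) N where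
  toFun n := (balancedRelations B B (TwistedBimodule φ) N).mkQ
    ((show TwistedBimodule φ from (1 : B)) ⊗ₜ[ℤ] n)
  map_zero' := by rw [TensorProduct.tmul_zero, map_zero]
  map_add' x y := by rw [TensorProduct.tmul_add, map_add]

variable {N}

theorem mkQ_tmul_eq_oneTensor (x : B) (n : N) :
    (balancedRelations B B (TwistedBimodule φ) N).mkQ
      ((show TwistedBimodule φ from x) ⊗ₜ[ℤ] n) = oneTensor φ N (x • n) := by
  rw [← sub_eq_zero]
  change _ - (balancedRelations B B (TwistedBimodule φ) N).mkQ _ = 0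
  rw [← map_sub]
  refine (Submodule.Quotient.mk_eq_zero _).2
    (Submodule.subset_span ⟨(show TwistedBimodule φ from (1 : B)), x, n, ?_⟩)
  have h : MulOpposite.op x • (show TwistedBimodule φ from (1 : B)) =
    (show TwistedBimodule φ from x) := one_mul x
  rw [h]

theorem smul_oneTensor (b : B) (n : N) : b • oneTensor φ N n = oneTensor φ N (φ b • n) := by
  rw [← mkQ_tmul_eq_oneTensor]
  change b • (balancedRelations B B (TwistedBimodule φ) N).mkQ _ = _
  rw [← map_smul, TensorProduct.smul_tmul']
  have h : b • (show TwistedBimodule φ from (1 : B)) = (show TwistedBimodule φ from φ b) :=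
    mul_one (φ b)
  rw [h]

theorem oneTensor_bijective : Function.Bijective (oneTensor φ N) := by
  constructor
  · rw [injective_iff_map_eq_zero]
    intro n hn
    -- The inverse x ⊗ n ↦ xn is only φ-semilinear, which still suffices to kill the B-span of the
    -- relations.
    let g : (TwistedBimodule φ) ⊗[ℤ] N →+ N :=
      (TensorProduct.lift
        (LinearMap.mk₂ ℤ (fun (x : TwistedBimodule φ) (n : N) => (show B from x) • n)
          (fun x y n => add_smul (show B from x) (show B from y) n)
          (fun z x n => smul_assoc z (show B from x) n)
          (fun x n m => smul_add (show B from x) n m)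
          (fun z x n => smul_comm (show B from x) z n))).toAddMonoidHom
    have hg (x : TwistedBimodule φ) (n : N) : g (x ⊗ₜ n) = (show B from x) • n := rfl
    have hsmul (b : B) (y : (TwistedBimodule φ) ⊗[ℤ] N) : g (b • y) = φ b • g y := by
      induction y using TensorProduct.induction_on with
      | zero => rw [smul_zero, map_zero, smul_zero]
      | tmul x m =>
        rw [TensorProduct.smul_tmul', hg, hg, ← mul_smul]
        rfl
      | add x y hx hy => rw [smul_add, map_add, hx, hy, map_add, smul_add]
    have hrel (y) (hy : y ∈ balancedRelations B B (TwistedBimodule φ) N) : g y = 0 := by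
      induction hy using Submodule.span_induction with
      | mem y hy =>
        obtain ⟨x, r, m, rfl⟩ := hy
        rw [map_sub, hg, hg, sub_eq_zero, ← mul_smul]
        rfl
      | zero => exact map_zero g
      | add x y _ _ hx hy => rw [map_add, hx, hy, add_zero]
      | smul b x _ hx => rw [hsmul, hx, smul_zero]
    have h := hrel _ ((Submodule.Quotient.mk_eq_zero _).1 hn)
    rw [hg] at h
    exact (one_smul B n).symm.trans h
  · intro y
    obtain ⟨t, rfl⟩ := (balancedRelations B B (TwistedBimodule φ) N).mkQ_surjective y
    induction t using TensorProduct.induction_on with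
    | zero => exact ⟨0, by rw [map_zero, map_zero]⟩
    | tmul x m => exact ⟨(show B from x) • m, (mkQ_tmul_eq_oneTensor φ x m).symm⟩
    | add x y hx hy =>
      obtain ⟨a, ha⟩ := hx
      obtain ⟨b, hb⟩ := hy
      exact ⟨a + b, by rw [map_add, map_add, ha, hb]⟩

end TwistedTensor

/-! ### Identification of F and the decomposition -/

section Comparison

variable {k : Type v} {A : Type u} [Field k] [Ring A] [Algebra k A]
  {F : FGModuleCat.{u} A ⥤ FGModuleCat.{u} A} {e : A} (D : TwistData F e)
  {B C : Type u} [Ring B] [Ring C] [Algebra k B] [Algebra k C] (E : A ≃ₐ[k] B × C)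
  (φ : B ≃ₐ[k] B)

theorem TwistData.nonempty_iso (hE : E e = (1, 0)) (hφ : ∀ a, φ (E a).1 = (E (D.c a)).1) :
    Nonempty (F ≅ transportFunctor (E : A ≃+* B × C)
      (externalSum (twistFunctor φ) (zeroFunctor C))) := by
  have hE' : E.symm (1, 0) = e := by rw [← hE, AlgEquiv.symm_apply_apply]
  let G := transportFunctor (E : A ≃+* B × C) (externalSum (twistFunctor φ) (zeroFunctor C))
  let R (M : FGModuleCat.{u} A) : FGModuleCat.{u} (B × C) :=
    (restrictFG ((E : A ≃+* B × C).symm : B × C →+* A) (E : A ≃+* B × C).symm.surjective).obj M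
  let P (M : FGModuleCat.{u} A) := FstPart (B := B) (C := C) (R M)
  let α (M : FGModuleCat.{u} A) (x : F.obj M) : P M := ⟨D.α M x, by
    change E.symm (1, 0) • D.α M x = D.α M x
    rw [hE', D.e_smul_α]⟩
  -- FM embeds onto eM, which is the B-component of M, followed by n ↦ 1 ⊗ n; the C-component of the
  -- target is zero.
  let γ (M : FGModuleCat.{u} A) : F.obj M →ₗ[A] G.obj M :=
    { toFun := fun x => ((oneTensor φ (P M) (α M x), PUnit.unit) :
        BalancedTensor B B (TwistedBimodule φ) (P M) × PUnit)
      map_add' := fun x y => Prod.ext ((congrArg (oneTensor φ (P M)) (Subtype.ext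
        (map_add (D.α M) x y))).trans (map_add (oneTensor φ (P M)) _ _)) rfl
      map_smul' := fun a x => by
        refine Prod.ext ?_ rfl
        change oneTensor φ (P M) (α M (a • x)) = (E a).1 • oneTensor φ (P M) (α M x)
        rw [smul_oneTensor, hφ]
        congr 1
        apply Subtype.ext
        change D.α M (a • x) = E.symm ((E (D.c a)).1, 0) • D.α M x
        have h : ((E (D.c a)).1, (0 : C)) = E (D.c a * e) := by
          rw [map_mul, hE]
          ext <;> simp
        rw [h, AlgEquiv.symm_apply_apply, D.mul_e, D.α_smul] }
  have hγ (M : FGModuleCat.{u} A) : Function.Bijective (γ M) := by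
    constructor
    · intro x y h
      have h1 := (oneTensor_bijective φ).1 (congrArg Prod.fst h)
      exact D.injective M (congrArg Subtype.val h1)
    · rintro ⟨y, z⟩
      obtain ⟨n, rfl⟩ := (oneTensor_bijective φ).2 y
      obtain ⟨x, hx⟩ := (D.smul_eq_iff M n.1).1 (by
        have h1 : E.symm (1, 0) • (show M from n.1) = n.1 := n.2
        rwa [hE'] at h1)
      exact ⟨x, Prod.ext (congrArg (oneTensor φ (P M)) (Subtype.ext hx)) rfl⟩
  refine ⟨NatIso.ofComponents
    (fun M => (LinearEquiv.ofBijective (γ M) (hγ M)).toFGModuleCatIso) fun {M N} f => ?_⟩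
  refine FGModuleCat.hom_ext (LinearMap.ext fun x => ?_)
  refine Prod.ext ?_ rfl
  exact congrArg (oneTensor φ (P N)) (Subtype.ext (D.naturality f x))

end Comparison

/-- If all counits of the selfadjunction are monomorphisms, then `F` is a twist by an automorphism
on one direct factor of `A`, and zero on the complementary one. -/
theorem exists_twist_decomposition {k : Type v} {A : Type u} [Field k] [Infinite k] [Ring A]
    [Algebra k A] [FiniteDimensional k A] (hA : IsBasicAlgebra k A)
    {F : FGModuleCat.{u} A ⥤ FGModuleCat.{u} A} [F.Additive] [F.Linear k] (adj : F ⊣ F)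
    (hε : ∀ X, Mono (adj.counit.app X)) :
    ∃ (B C : Type u) (_ : Ring B) (_ : Ring C) (_ : Algebra k B) (_ : Algebra k C)
      (e : A ≃ₐ[k] B × C) (φ : B ≃ₐ[k] B), IsInnerAut (φ * φ) ∧
      Nonempty (F ≅ transportFunctor (e : A ≃+* B × C)
        (externalSum (twistFunctor φ) (zeroFunctor C))) := by
  obtain ⟨e, hee, hce, hinj, hfix, hid⟩ := exists_central_idempotent adj hε
  obtain ⟨t, ht⟩ := exists_span_singleton_eq_top (k := k) adj hA hε
  have hann := smul_eq_zero_iff_of_span_eq_top (k := k) adj hee hce hfix hid ht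
  obtain ⟨D, hD⟩ := exists_twistData adj hee hid ht hann
  obtain ⟨B, _, _, p, hp, hp0⟩ := exists_quotient_of_central k hce
  obtain ⟨C, _, _, q, hq, hq0⟩ := exists_quotient_of_central k (e := 1 - e) fun a => by
    rw [mul_sub, sub_mul, mul_one, one_mul, hce]
  obtain ⟨E, hE⟩ := exists_algEquiv_prod hee hp hq hp0 hq0
  obtain ⟨φ, hφ⟩ := D.exists_algEquiv hee hid
    (fun a ha => TwistData.mul_eq_zero_of_c_eq_zero adj hce hee hfix ht D hD ha) hp hp0
  have hpe : p e = 1 := by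
    rw [← sub_eq_zero, ← map_one p, ← map_sub, hp0, sub_mul, hee, one_mul, sub_self]
  refine ⟨B, C, _, _, _, _, E, φ, ?_, D.nonempty_iso E φ ?_ fun a => ?_⟩
  · obtain ⟨s, hs, a, ha⟩ := D.exists_inner adj hce hee hinj hfix hid
    refine isInnerAut_of_mul_eq (φ * φ) (s := p s) (t := p a) (fun b => ?_) ?_
    · obtain ⟨b, rfl⟩ := hp b
      rw [AlgEquiv.mul_apply, hφ, hφ, ← map_mul, ← map_mul, hs]
    · rw [← map_mul, ha, hpe]
  · rw [hE, hpe, (hq0 e).2 (by rw [mul_sub, mul_one, hee, sub_self])]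
  · rw [hE, hE, hφ]

end SelfadjointFunctors

end

theorem mainTheorem3 (𝕜 : Type v) (A : Type u) [Field 𝕜] [IsAlgClosed 𝕜] [Ring A]
    [Algebra 𝕜 A] [FiniteDimensional 𝕜 A] (hA : SelfadjointFunctors.IsBasicAlgebra 𝕜 A)
    (k m : ℕ) (hm : 1 ≤ m) (hk : m < k) :
    (∀ (F : FGModuleCat.{u} A ⥤ FGModuleCat.{u} A) [F.Additive] [F.Linear 𝕜],
      SelfadjointFunctors.IsSelfadjointFunctor F →
      Nonempty (SelfadjointFunctors.functorPow F k ≅ SelfadjointFunctors.functorPow F m) →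
      (Odd (k - m) → Nonempty (SelfadjointFunctors.functorPow F 2 ≅ F)) ∧
      (Even (k - m) →
        ∃ (B C : Type u) (_ : Ring B) (_ : Ring C) (_ : Algebra 𝕜 B) (_ : Algebra 𝕜 C)
          (e : A ≃ₐ[𝕜] B × C) (φ : B ≃ₐ[𝕜] B),
          SelfadjointFunctors.IsInnerAut (φ * φ) ∧
          Nonempty (F ≅ SelfadjointFunctors.transportFunctor (e : A ≃+* B × C)
            (SelfadjointFunctors.externalSum (SelfadjointFunctors.twistFunctor φ)
              (SelfadjointFunctors.zeroFunctor C))))) ∧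
    (∀ (F : FGModuleCat.{u} A ⥤ FGModuleCat.{u} A),
      Nonempty (SelfadjointFunctors.functorPow F 2 ≅ F) →
      Nonempty (SelfadjointFunctors.functorPow F k ≅ SelfadjointFunctors.functorPow F m)) := by
  refine ⟨fun F _ _ ⟨adj⟩ hkm => ?_, fun F h => ?_⟩
  · have hd : 1 ≤ k - m := by lia
    have hkm' : Nonempty (SelfadjointFunctors.functorPow F (m + (k - m)) ≅
        SelfadjointFunctors.functorPow F m) := by
      rwa [Nat.add_sub_cancel' hk.le]
    have hη := SelfadjointFunctors.epi_unit_app 𝕜 adj hm hd hkm'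
    have hε := SelfadjointFunctors.mono_counit_app 𝕜 adj hm hd hkm'
    refine ⟨fun hodd => ?_, fun _ => ?_⟩
    · exact SelfadjointFunctors.functorPow_iso_of_odd_sub F
        (SelfadjointFunctors.functorPow_three_iso adj hη) hm hkm hodd
    · have : Infinite 𝕜 := IsAlgClosed.instInfinite
      exact SelfadjointFunctors.exists_twist_decomposition hA adj hε
  · exact ⟨(SelfadjointFunctors.functorPow_iso_of_idempotent F h (hm.trans hk.le)).some ≪≫
      (SelfadjointFunctors.functorPow_iso_of_idempotent F h hm).some.symm⟩
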